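/- A \emph{mixed graph} $G=(V;D,L)$ consists of a finite nonempty vertex set $V$, a set $D$ of direction edges and a set $L$ of length edges; there are no loops, and parallel edges occur only as one direction edge together with one length edge. For $p,q:V\to\mathbb{R}^2$, the framework $(G,q)$ is \emph{equivalent} to $(G,p)$ if $p(u)-p(v)$ is a scalar multiple of $q(u)-q(v)$ for all $uv\in D$ with $q(u)\ne q(v)$, and $\|p(u)-p(v)\|=\|q(u)-q(v)\|$ for all $uv\in L$; $p$ and $q$ are \emph{congruent} if $p(u)-p(v)=q(u)-q(v)$ for all $u,v\in V$, or $p(u)-p(v)=q(v)-q(u)$ for all $u,v\in V$. The framework $(G,p)$ is \emph{rigid} if there is $\varepsilon>0$ such that $p$ is congruent to $q$ whenever $(G,q)$ is equivalent to $(G,p)$ and $\|p(v)-q(v)\|<\varepsilon$ for all $v\in V$. It is \emph{generic} if the coordinates of the points $p(v)$, $v\in V$, are algebraically independent over $\mathbb{Q}$. The graph $G$ is \emph{rigid} if some generic realisation $(G,p)$ is rigid. The \emph{rigidity matrix} $R(G,p)$ has one row for each edge and two columns for each vertex; if the edge $e$ is oriented from $u$ to $v$ and $p(u)-p(v)=(a,b)$,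 then its row is $(a,b)$ at $u$ and $(-a,-b)$ at $v$ if $e\in L$, is $(b,-a)$ at $u$ and $(-b,a)$ at $v$ if $e\in D$, and is zero elsewhere. The \emph{rigidity matroid} $M(G)$ on $D\cup L$ is the row matroid of $R(G,p)$ for generic $p$. The graph $G$ is \emph{direction-independent} if $D$ is independent in $M(G)$. $G$ is \emph{direction reducible} to a subgraph $H$ if either (R1) $H=G-e$ for some $e\in D$ that belongs to a circuit of $M(G)$ consisting of direction edges only, or (R2) $H$ is a proper induced subgraph of $G$, and the multigraph $G/H$, obtained from $G$ by contracting $H$ to a single vertex (deleting all edges of $H$ and keeping all other edges of $G$, possibly as parallel edges), has only direction edges and is the union of two edge-disjoint spanning trees. \textbf{Lemma.} Let $G=(V;D,L)$ be a rigid, direction-independent mixed graph and let $H=(V';D',L')$ be an induced proper subgraph of $G$. Then $G$ is direction reducible to $H$ if and only if $L'=L$ and $|D\setminus D'|=2|V\setminus V'|$. -/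

import Mathlib

/-- The plane with its Euclidean norm. -/
abbrev Plane : Type := EuclideanSpace ℝ (Fin 2)

/-- A finite mixed graph `(V; D, L)` with vertices in `α`: a nonempty finite vertex set `V`, a set
`D` of direction edges and a set `L` of length edges. There are no loops, and parallel edges occur
only as one direction edge together with one length edge. -/
@[ext]
structure MixedGraph (α : Type*) where
  /-- the vertex set -/
  V : Finset α
  /-- the direction edges -/
  D : Finset (Sym2 α)
  /-- the length edges -/
  L : Finset (Sym2 α)
  nonempty : V.Nonempty
  dir_not_isDiag : ∀ e ∈ D, ¬ e.IsDiag
  len_not_isDiag : ∀ e ∈ L, ¬ e.IsDiag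
  dir_ends : ∀ e ∈ D, ∀ v ∈ e, v ∈ V
  len_ends : ∀ e ∈ L, ∀ v ∈ e, v ∈ V

namespace MixedGraph

/-- Labels of edges: `Sum.inl s(u, v)` is a direction edge and `Sum.inr s(u, v)` is a length edge
between `u` and `v`. -/
abbrev Edge (α : Type*) : Type _ := Sym2 α ⊕ Sym2 α

/-- The underlying set of end vertices of an edge. -/
def Edge.ends {α : Type*} : Edge α → Sym2 α := Sum.elim id id

/-- The edge set `D ∪ L` (as a disjoint union). -/
def edges {α : Type*} (G : MixedGraph α) : Finset (Edge α) := G.D.disjSum G.L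

/-- `G - e` for a direction edge `e`. -/
def deleteDir {α : Type*} [DecidableEq α] (G : MixedGraph α) (e : Sym2 α) : MixedGraph α where
  V := G.V
  D := G.D.erase e
  L := G.L
  nonempty := G.nonempty
  dir_not_isDiag f hf := G.dir_not_isDiag f (Finset.mem_of_mem_erase hf)
  len_not_isDiag := G.len_not_isDiag
  dir_ends f hf := G.dir_ends f (Finset.mem_of_mem_erase hf)
  len_ends := G.len_ends

/-- `H` is an induced subgraph of `G`: its vertices are vertices of `G`, and its edges are exactly
the edges of `G` with both ends in the vertex set of `H`. -/
structure IsInducedSubgraph {α : Type*} (H G : MixedGraph α) : Prop where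
  verts_subset : H.V ⊆ G.V
  mem_dir_iff : ∀ e, e ∈ H.D ↔ e ∈ G.D ∧ ∀ v ∈ e, v ∈ H.V
  mem_len_iff : ∀ e, e ∈ H.L ↔ e ∈ G.L ∧ ∀ v ∈ e, v ∈ H.V

/-- `H` is an induced subgraph of `G` different from `G`. -/
def IsProperInducedSubgraph {α : Type*} (H G : MixedGraph α) : Prop :=
  H.IsInducedSubgraph G ∧ H ≠ G

/-! ### Frameworks

A realisation of `G` is given by a map `p : α → Plane`, of which only the values on `G.V` matter. -/

/-- The frameworks `(G, p)` and `(G, q)` are equivalent. -/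
def Equivalent {α : Type*} (G : MixedGraph α) (p q : α → Plane) : Prop :=
  (∀ u v, s(u, v) ∈ G.D → q u ≠ q v → ∃ c : ℝ, p u - p v = c • (q u - q v)) ∧
  (∀ u v, s(u, v) ∈ G.L → ‖p u - p v‖ = ‖q u - q v‖)

/-- The point configurations `p` and `q` for the vertex set of `G` are congruent. -/
def Congruent {α : Type*} (G : MixedGraph α) (p q : α → Plane) : Prop :=
  (∀ u ∈ G.V, ∀ v ∈ G.V, p u - p v = q u - q v) ∨
  (∀ u ∈ G.V, ∀ v ∈ G.V, p u - p v = q v - q u)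

/-- The framework `(G, p)` is rigid. -/
def IsRigidFramework {α : Type*} (G : MixedGraph α) (p : α → Plane) : Prop :=
  ∃ ε : ℝ, 0 < ε ∧ ∀ q : α → Plane,
    G.Equivalent p q → (∀ v ∈ G.V, ‖p v - q v‖ < ε) → G.Congruent p q

/-- The framework `(G, p)` is generic: the coordinates of the points `p v`, `v ∈ V`, are
algebraically independent over `ℚ`. -/
def IsGeneric {α : Type*} (G : MixedGraph α) (p : α → Plane) : Prop :=
  AlgebraicIndependent ℚ (fun x : G.V × Fin 2 => p (x.1 : α) x.2)

/-- The mixed graph `G` is rigid: some generic realisation of `G` is rigid. -/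
def IsRigid {α : Type*} (G : MixedGraph α) : Prop :=
  ∃ p : α → Plane, G.IsGeneric p ∧ G.IsRigidFramework p

/-! ### The rigidity matroid -/

/-- For `p u - p v = (a, b)`, the entries of the row of an edge oriented from `u` to `v` in the
two columns of `u`: `(b, -a)` for a direction edge and `(a, b)` for a length edge. -/
def edgeVec {α : Type*} (p : α → Plane) (e : Edge α) (u v : α) : Fin 2 → ℝ :=
  match e with
  | Sum.inl _ => ![(p u - p v) 1, -(p u - p v) 0]
  | Sum.inr _ => ![(p u - p v) 0, (p u - p v) 1]

/-- The row of the rigidity matrix `R(G, p)` that belongs to the edge `e`. The columns are indexed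
by `V × {0, 1}`, and the edge has the reference orientation from the first to the second component
of the chosen pair `Quot.out e.ends`. -/
noncomputable def rigidityRow {α : Type*} [DecidableEq α] (G : MixedGraph α) (p : α → Plane)
    (e : Edge α) : G.V × Fin 2 → ℝ :=
  let u := (Quot.out e.ends).1
  let v := (Quot.out e.ends).2
  fun x => (if (x.1 : α) = u then edgeVec p e u v x.2 else 0) -
    (if (x.1 : α) = v then edgeVec p e u v x.2 else 0)

/-- Augmentation for finite families of vectors. -/
theorem exists_linearIndepOn_insert {ι W : Type*} [AddCommGroup W] [Module ℝ W] {v : ι → W}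
    {I J : Set ι} (hIfin : I.Finite) (hJfin : J.Finite) (hI : LinearIndepOn ℝ v I)
    (hJ : LinearIndepOn ℝ v J) (hlt : I.ncard < J.ncard) :
    ∃ e ∈ J, e ∉ I ∧ LinearIndepOn ℝ v (insert e I) := by
  classical
  by_contra! hcon
  have hspan : ∀ e ∈ J, v e ∈ Submodule.span ℝ (v '' I) := by
    intro e he
    by_cases heI : e ∈ I
    · exact Submodule.subset_span ⟨e, heI, rfl⟩
    · by_contra hne
      exact hcon e he heI (hI.insert hne)
  have hle : Submodule.span ℝ (v '' J) ≤ Submodule.span ℝ (v '' I) := by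
    rw [Submodule.span_le]
    rintro _ ⟨e, he, rfl⟩
    exact hspan e he
  have hfinI : (v '' I).Finite := hIfin.image v
  have : FiniteDimensional ℝ (Submodule.span ℝ (v '' I)) :=
    FiniteDimensional.span_of_finite ℝ hfinI
  have hmono := Submodule.finrank_mono hle
  have hcard : ∀ {K : Set ι}, K.Finite → LinearIndepOn ℝ v K →
      Module.finrank ℝ (Submodule.span ℝ (v '' K)) = K.ncard := by
    intro K hKfin hK
    have : Fintype K := hKfin.fintype
    have h := finrank_span_eq_card (R := ℝ) (b := fun x : K => v x) hK
    rw [Set.image_eq_range, h, ← Nat.card_eq_fintype_card, Nat.card_coe_set_eq]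
  rw [hcard hIfin hI, hcard hJfin hJ] at hmono
  omega

/-- The rigidity matroid of the framework `(G, p)`: its ground set is the edge set of `G`, and a
set of edges is independent when the corresponding rows of the rigidity matrix are linearly
independent. -/
noncomputable def frameworkMatroid {α : Type*} [DecidableEq α] (G : MixedGraph α)
    (p : α → Plane) : Matroid (Edge α) :=
  (IndepMatroid.ofFinite (E := (G.edges : Set (Edge α))) G.edges.finite_toSet
    (fun F => F ⊆ (G.edges : Set (Edge α)) ∧ LinearIndepOn ℝ (G.rigidityRow p) F)
    ⟨Set.empty_subset _, linearIndepOn_empty ℝ _⟩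
    (fun _ _ hJ hIJ => ⟨hIJ.trans hJ.1, hJ.2.mono hIJ⟩)
    (fun I J hI hJ hlt => by
      obtain ⟨e, heJ, heI, he⟩ := exists_linearIndepOn_insert
        (G.edges.finite_toSet.subset hI.1) (G.edges.finite_toSet.subset hJ.1) hI.2 hJ.2 hlt
      exact ⟨e, heJ, heI, Set.insert_subset (hJ.1 heJ) hI.1, he⟩)
    (fun _ hI => hI.1)).matroid

/-- `F` is independent in the rigidity matroid `M(G)` of `G`, the common rigidity matroid of all
generic realisations of `G`. -/
def IsMIndep {α : Type*} [DecidableEq α] (G : MixedGraph α) (F : Set (Edge α)) : Prop :=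
  ∀ p : α → Plane, G.IsGeneric p → (G.frameworkMatroid p).Indep F

/-- `C` is a circuit of the rigidity matroid `M(G)` of `G`. -/
def IsMCircuit {α : Type*} [DecidableEq α] (G : MixedGraph α) (C : Set (Edge α)) : Prop :=
  ∀ p : α → Plane, G.IsGeneric p → (G.frameworkMatroid p).IsCircuit C

/-- `G` is direction-independent: `D` is independent in the rigidity matroid of `G`. -/
def IsDirectionIndependent {α : Type*} [DecidableEq α] (G : MixedGraph α) : Prop :=
  G.IsMIndep (Sum.inl '' (G.D : Set (Sym2 α)))

/-- A set of edges is direction-pure if all its members are direction edges. -/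
def DirectionPure {α : Type*} (F : Set (Edge α)) : Prop :=
  ∀ e ∈ F, e.isLeft = true

/-! ### Contraction and spanning trees -/

/-- The mixed graph `G` as a multigraph with edge set `G.edges`. -/
def toGraph {α : Type*} (G : MixedGraph α) : Graph α (Edge α) where
  vertexSet := (G.V : Set α)
  edgeSet := (G.edges : Set (Edge α))
  IsLink e x y := e ∈ G.edges ∧ e.ends = s(x, y)
  isLink_symm _ _ := ⟨fun _ _ h => ⟨h.1, h.2.trans Sym2.eq_swap⟩⟩
  eq_or_eq_of_isLink_of_isLink _ x y v w h h' := by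
    have h2 : s(x, y) = s(v, w) := h.2.symm.trans h'.2
    rcases Sym2.eq_iff.1 h2 with h3 | h3
    · exact Or.inl h3.1
    · exact Or.inr h3.1
  edge_mem_iff_exists_isLink e := by
    constructor
    · intro he
      obtain ⟨⟨x, y⟩, hxy⟩ := Quot.exists_rep e.ends
      exact ⟨x, y, he, hxy.symm⟩
    · rintro ⟨x, y, he, -⟩
      exact he
  left_mem_of_isLink e x y h := by
    obtain ⟨he, hxy⟩ := h
    rcases e with e | e
    · exact G.dir_ends e (Finset.inl_mem_disjSum.1 he) x (by
        rw [show e = s(x, y) from hxy]; exact Sym2.mem_mk_left x y)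
    · exact G.len_ends e (Finset.inr_mem_disjSum.1 he) x (by
        rw [show e = s(x, y) from hxy]; exact Sym2.mem_mk_left x y)

/-- The vertex map of the contraction of `H`: all vertices of `H` go to the new vertex `none`. -/
def contractMap {α : Type*} [DecidableEq α] (H : MixedGraph α) (v : α) : Option α :=
  if v ∈ H.V then none else some v

/-- The multigraph `G / H` obtained from `G` by contracting `H` to a single vertex: all edges of
`H` are deleted, and all other edges of `G` are kept, possibly as parallel edges. -/
def contract {α : Type*} [DecidableEq α] (G H : MixedGraph α) : Graph (Option α) (Edge α) :=
  (G.toGraph.deleteEdges (H.edges : Set (Edge α))).map H.contractMap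

end MixedGraph

/-- A multigraph is a tree: it has no loops and no parallel edges, and as a simple graph it is
connected and acyclic. -/
def Graph.IsMultigraphTree {β ε : Type*} (T : Graph β ε) : Prop :=
  T.Simple ∧ T.toSimpleGraph.IsTree

/-- `Γ` is the union of two edge-disjoint spanning trees. -/
def Graph.IsUnionOfTwoSpanningTrees {β ε : Type*} (Γ : Graph β ε) : Prop :=
  ∃ T₁ T₂ : Graph β ε, T₁.IsSpanningSubgraph Γ ∧ T₂.IsSpanningSubgraph Γ ∧
    T₁.IsMultigraphTree ∧ T₂.IsMultigraphTree ∧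
    Disjoint T₁.edgeSet T₂.edgeSet ∧ T₁.edgeSet ∪ T₂.edgeSet = Γ.edgeSet

namespace MixedGraph

/-- First reduction: `H = G - e` for a direction edge `e` that belongs to a direction-pure circuit
of the rigidity matroid of `G`. -/
def DirectionReductionDelete {α : Type*} [DecidableEq α] (G H : MixedGraph α) : Prop :=
  ∃ e ∈ G.D, (∃ C : Set (Edge α), G.IsMCircuit C ∧ DirectionPure C ∧ Sum.inl e ∈ C) ∧
    H = G.deleteDir e

/-- Second reduction: `H` is a proper induced subgraph of `G`, and `G / H` is direction-pure and is
the union of two edge-disjoint spanning trees. -/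
def DirectionReductionContract {α : Type*} [DecidableEq α] (G H : MixedGraph α) : Prop :=
  H.IsProperInducedSubgraph G ∧ DirectionPure (G.contract H).edgeSet ∧
    (G.contract H).IsUnionOfTwoSpanningTrees

/-- `G` is direction reducible to `H`, i.e. `G` admits a direction reduction to `H`. -/
def DirectionReducibleTo {α : Type*} [DecidableEq α] (G H : MixedGraph α) : Prop :=
  G.DirectionReductionDelete H ∨ G.DirectionReductionContract H

end MixedGraph

/-!
Let `(G, p)` be rigid. A displacement `d` that vanishes on `H`, which contains all length edges, and
satisfies the linear direction constraints of the remaining edges gives equivalent frameworks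
`p + t d` for all `t`, hence is zero. So the system of these constraints, one equation
`a (f u - f v) = b (g u - g v)` with `(b, a) = p u - p v` for each edge `uv` of `G / H`, in the
coordinates `f`, `g` of `d`, has only the trivial solution. If moreover
`|D \ D'| = 2 |V \ V'|`, the system is square and its determinant does not vanish. Expanding it by
rows splits the edges of `G / H` into two sets, on each of which the functionals `f u - f v` are
linearly independent; by their sizes these are the edge sets of two spanning trees. The converse is
the edge count of two spanning trees.
-/

section LinearAlgebra

variable {ι K M N : Type*} [Field K] [AddCommGroup M] [Module K M] [AddCommGroup N] [Module K N]

theorem exists_linearIndependent_piecewise [Finite ι] [DecidableEq ι] {x y : ι → M}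
    (h : LinearIndependent K (x + y)) :
    ∃ s : Finset ι, LinearIndependent K (s.piecewise x y) := by
  have := Fintype.ofFinite ι
  obtain ⟨g, hg⟩ := LinearMap.exists_leftInverse_of_injective (Fintype.linearCombination K (x + y))
    (LinearMap.ker_eq_bot.2 (linearIndependent_iff_injective_fintypeLinearCombination.1 h))
  have hg_add : g ∘ x + g ∘ y = (1 : Matrix ι ι K) := by
    ext i j
    have := congrFun (LinearMap.congr_fun hg (Pi.single i 1)) j
    simpa [Fintype.linearCombination_apply_single, Matrix.one_apply, Pi.single_apply, eq_comm]
      using this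
  -- The determinant is additive in each row: expand `det 1 = det (g ∘ x + g ∘ y)`.
  have hdet : ∑ s : Finset ι, Matrix.detRowAlternating (s.piecewise (g ∘ x) (g ∘ y)) ≠ 0 := by
    rw [← AlternatingMap.map_add_univ, hg_add]
    exact Matrix.det_one.trans_ne one_ne_zero
  obtain ⟨s, -, hs⟩ := Finset.exists_ne_zero_of_sum_ne_zero hdet
  refine ⟨s, .of_comp g ?_⟩
  have hcomp : g ∘ s.piecewise x y = s.piecewise (g ∘ x) (g ∘ y) :=
    funext fun i => apply_ite g _ _ _
  exact hcomp ▸ Matrix.linearIndependent_rows_of_det_ne_zero hs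

theorem exists_linearIndepOn_compl [Finite ι] {x : ι → M} {y : ι → N}
    (h : LinearIndependent K fun i => (x i, y i)) :
    ∃ S : Set ι, LinearIndepOn K x S ∧ LinearIndepOn K y Sᶜ := by
  classical
  have hadd : (fun i => (x i, y i)) = LinearMap.inl K M N ∘ x + LinearMap.inr K M N ∘ y := by
    ext i <;> simp
  obtain ⟨s, hs⟩ := exists_linearIndependent_piecewise (hadd ▸ h)
  refine ⟨s, .of_comp (LinearMap.inl K M N) ?_, .of_comp (LinearMap.inr K M N) ?_⟩
  · exact (hs.linearIndepOn s).congr fun i hi => Finset.piecewise_eq_of_mem s _ _ hi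
  · exact (hs.linearIndepOn (↑s)ᶜ).congr fun i hi => Finset.piecewise_eq_of_notMem s _ _ hi

theorem linearIndependent_of_linearIndependent_smul {c : ι → K} {x : ι → M}
    (h : LinearIndependent K fun i => c i • x i) : LinearIndependent K x := by
  have hc (i : ι) : c i ≠ 0 := fun hci => h.ne_zero i (by rw [hci, zero_smul])
  exact (LinearIndependent.units_smul_iff x fun i => Units.mk0 (c i) (hc i)).1 h

theorem linearIndependent_dual_iff [Finite ι] [FiniteDimensional K M] {φ : ι → Module.Dual K M}
    (hcard : Nat.card ι = Module.finrank K M) :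
    LinearIndependent K φ ↔ ∀ v, (∀ i, φ i v = 0) → v = 0 := by
  have := Fintype.ofFinite ι
  replace hcard : Fintype.card ι = Module.finrank K (Module.Dual K M) := by
    rw [Subspace.dual_finrank_eq, ← hcard, Nat.card_eq_fintype_card]
  constructor
  · intro hφ v hv
    refine (Module.forall_dual_apply_eq_zero_iff K v).1 fun ψ => ?_
    have hspan : Submodule.span K (Set.range φ) ≤ LinearMap.ker (Module.Dual.eval K M v) :=
      Submodule.span_le.2 (Set.range_subset_iff.2 hv)
    rw [hφ.span_eq_top_of_card_eq_finrank' hcard] at hspan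
    exact hspan Submodule.mem_top
  · intro hφ
    refine linearIndependent_of_top_le_span_of_card_eq_finrank (fun ψ _ => ?_) hcard
    refine mem_span_of_iInf_ker_le_ker fun v hv => ?_
    rw [hφ v fun i => (Submodule.mem_iInf _).1 hv i]
    exact Submodule.zero_mem _

theorem exists_linearIndepOn_compl_of_forall_eq_zero [Finite ι] [FiniteDimensional K M]
    {φ : ι → Module.Dual K M} (a b : ι → K) (hcard : Nat.card ι = 2 * Module.finrank K M)
    (h : ∀ u v, (∀ i, a i * φ i u = b i * φ i v) → u = 0 ∧ v = 0) :
    ∃ S : Set ι, LinearIndepOn K φ S ∧ LinearIndepOn K φ Sᶜ := by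
  have hrows : LinearIndependent K fun i => (a i • φ i, -b i • φ i) := by
    refine .of_comp (Module.dualProdDualEquivDual K M M).toLinearMap ?_
    rw [linearIndependent_dual_iff (by rw [hcard, Module.finrank_prod, two_mul])]
    rintro ⟨u, v⟩ huv
    refine Prod.mk_eq_zero.2 (h u v fun i => ?_)
    simpa [← sub_eq_add_neg, sub_eq_zero] using huv i
  obtain ⟨S, hS, hSc⟩ := exists_linearIndepOn_compl hrows
  exact ⟨S, linearIndependent_of_linearIndependent_smul hS,
    linearIndependent_of_linearIndependent_smul hSc⟩

end LinearAlgebra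

section Graph

open scoped Graph

variable {β ε : Type*} {T Γ : Graph β ε}

theorem exists_injective_edgeSet_toSimpleGraph (T : Graph β ε) :
    ∃ φ : T.toSimpleGraph.edgeSet → E(T), Function.Injective φ ∧
      ∀ z (x y : V(T)), T.IsLink (φ z) x y ↔ (z : Sym2 V(T)) = s(x, y) := by
  have hlink (z : T.toSimpleGraph.edgeSet) :
      ∃ e : E(T), ∀ x y : V(T), T.IsLink e x y ↔ (z : Sym2 V(T)) = s(x, y) := by
    obtain ⟨⟨x, y⟩, -, e, he⟩ := z
    refine ⟨⟨e, he.edge_mem⟩, fun x' y' => ?_⟩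
    rw [he.isLink_iff_sym2_eq, ← Sym2.map_mk, ← Sym2.map_mk]
    exact (Sym2.map.injective Subtype.val_injective).eq_iff
  choose φ hφ using hlink
  refine ⟨φ, fun z z' h => ?_, hφ⟩
  obtain ⟨⟨x, y⟩, hz⟩ := z
  exact Subtype.ext ((hφ z' x y).1 (h ▸ (hφ _ x y).2 rfl)).symm

theorem card_edgeSet_toSimpleGraph_le (hE : E(T).Finite) :
    Nat.card T.toSimpleGraph.edgeSet ≤ E(T).ncard := by
  have := hE.to_subtype
  obtain ⟨φ, hφ, -⟩ := exists_injective_edgeSet_toSimpleGraph T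
  exact Nat.card_le_card_of_injective φ hφ

theorem card_edgeSet_toSimpleGraph_eq_iff (hE : E(T).Finite) :
    Nat.card T.toSimpleGraph.edgeSet = E(T).ncard ↔ T.Simple := by
  have := hE.to_subtype
  obtain ⟨φ, hφ, hlink⟩ := exists_injective_edgeSet_toSimpleGraph T
  have hcard : Nat.card T.toSimpleGraph.edgeSet = E(T).ncard ↔ Function.Surjective φ := by
    refine ⟨fun h => (hφ.bijective_of_nat_card_le h.ge).surjective, fun h => ?_⟩
    exact Nat.card_congr (Equiv.ofBijective φ ⟨hφ, h⟩)
  rw [hcard]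
  constructor
  · intro hsurj
    have hrep {e x y} (he : T.IsLink e x y) : ∃ z : T.toSimpleGraph.edgeSet,
        φ z = e ∧ z.1 = s(⟨x, he.left_mem⟩, ⟨y, he.right_mem⟩) := by
      obtain ⟨z, hz⟩ := hsurj ⟨e, he.edge_mem⟩
      exact ⟨z, congrArg Subtype.val hz, (hlink z _ _).1 (hz ▸ he)⟩
    refine { not_isLoopAt := fun e x he => ?_, eq_of_isLink := fun e f x y he hf => ?_ }
    · obtain ⟨⟨z, hz⟩, -, rfl⟩ := hrep he
      exact T.toSimpleGraph.loopless.irrefl _ hz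
    · obtain ⟨z, rfl, hz⟩ := hrep he
      obtain ⟨z', rfl, hz'⟩ := hrep hf
      rw [Subtype.ext (hz.trans hz'.symm)]
  · rintro hT ⟨e, he⟩
    obtain ⟨x, y, hxy⟩ := T.exists_isLink_of_mem_edgeSet he
    let z : T.toSimpleGraph.edgeSet := ⟨s(⟨x, hxy.left_mem⟩, ⟨y, hxy.right_mem⟩),
      fun h => hT.not_isLoopAt e x (by
        obtain rfl : x = y := congrArg Subtype.val h
        exact hxy), e, hxy⟩
    exact ⟨z, Subtype.ext (hT.eq_of_isLink ((hlink z _ _).2 rfl) hxy)⟩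

theorem isMultigraphTree_iff_connected_and_ncard (hV : V(T).Finite) (hE : E(T).Finite) :
    T.IsMultigraphTree ↔ T.toSimpleGraph.Connected ∧ E(T).ncard + 1 = V(T).ncard := by
  have := hV.to_subtype
  have hle := card_edgeSet_toSimpleGraph_le hE
  rw [Graph.IsMultigraphTree, SimpleGraph.isTree_iff_connected_and_card,
    ← card_edgeSet_toSimpleGraph_eq_iff hE, Nat.card_coe_set_eq V(T)]
  constructor
  · rintro ⟨hcard, hconn, htree⟩
    exact ⟨hconn, hcard ▸ htree⟩
  · rintro ⟨hconn, hcard⟩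
    have hge := hconn.card_vert_le_card_edgeSet_add_one
    rw [Nat.card_coe_set_eq V(T)] at hge
    exact ⟨by omega, hconn, by omega⟩

theorem ncard_edgeSet_add_two_of_isUnionOfTwoSpanningTrees (hV : V(Γ).Finite) (hE : E(Γ).Finite)
    (h : Γ.IsUnionOfTwoSpanningTrees) : E(Γ).ncard + 2 = 2 * V(Γ).ncard := by
  obtain ⟨T₁, T₂, hT₁, hT₂, htree₁, htree₂, hdisj, hunion⟩ := h
  have hE₁ : E(T₁).Finite := hE.subset (hunion ▸ Set.subset_union_left)
  have hE₂ : E(T₂).Finite := hE.subset (hunion ▸ Set.subset_union_right)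
  have hcard₁ := ((isMultigraphTree_iff_connected_and_ncard (hT₁.vertexSet_eq ▸ hV) hE₁).1 htree₁).2
  have hcard₂ := ((isMultigraphTree_iff_connected_and_ncard (hT₂.vertexSet_eq ▸ hV) hE₂).1 htree₂).2
  rw [hT₁.vertexSet_eq] at hcard₁
  rw [hT₂.vertexSet_eq] at hcard₂
  rw [← hunion, Set.ncard_union_eq hdisj hE₁ hE₂]
  omega

theorem simpleGraph_connected_of_forall_eq_zero (R : Type*) [Zero R] [One R] [NeZero (1 : R)]
    {V : Type*} {G : SimpleGraph V} (r : V)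
    (h : ∀ f : V → R, f r = 0 → (∀ x y, G.Adj x y → f x = f y) → ∀ x, f x = 0) :
    G.Connected := by
  classical
  rw [SimpleGraph.connected_iff_exists_forall_reachable]
  refine ⟨r, fun x => ?_⟩
  by_contra hx
  have hind := h (fun v => if G.Reachable r v then 0 else 1) (if_pos (.refl r))
    (fun u v huv => if_congr ⟨(.trans · huv.reachable), (.trans · huv.symm.reachable)⟩ rfl rfl) x
  rw [if_neg hx] at hind
  exact one_ne_zero hind

/-- The functional `f ↦ f x - f y` on the functions that vanish outside of `W`. For `W` the set of
vertices of a graph other than a chosen root, the functionals of the edges are the rows of the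
incidence matrix with the column of the root deleted. -/
noncomputable def potentialDiff (K : Type*) [CommRing K] (W : Set β) (x y : β) :
    Module.Dual K (W → K) :=
  (LinearMap.proj (R := K) (φ := fun _ : β => K) x - LinearMap.proj y) ∘ₗ
    Function.ExtendByZero.linearMap K Subtype.val

variable {K : Type*} [Field K] {r : β}

theorem potentialDiff_apply (W : Set β) (x y : β) (f : W → K) :
    potentialDiff K W x y f =
      Function.extend Subtype.val f 0 x - Function.extend Subtype.val f 0 y :=
  rfl

theorem finrank_fun_sdiff_singleton_add_one {V : Set β} (hV : V.Finite) (hr : r ∈ V) :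
    Module.finrank K (↥(V \ {r}) → K) + 1 = V.ncard := by
  have := hV.fintype
  have := (hV.subset (Set.sdiff_subset (t := {r}))).fintype
  rw [Module.finrank_fintype_fun_eq_card, ← Nat.card_eq_fintype_card, Nat.card_coe_set_eq]
  exact Set.ncard_sdiff_singleton_add_one hr hV

theorem isMultigraphTree_restrict_of_linearIndepOn (hV : V(Γ).Finite) (hr : r ∈ V(Γ))
    {s t : E(Γ) → β} (hst : ∀ e : E(Γ), Γ.IsLink e (s e) (t e)) {F : Set E(Γ)}
    (hF : LinearIndepOn K (fun e => potentialDiff K (V(Γ) \ {r}) (s e) (t e)) F)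
    (hcard : F.ncard + 1 = V(Γ).ncard) :
    (Γ.restrict (Subtype.val '' F)).IsMultigraphTree := by
  have := (hV.subset (Set.sdiff_subset (t := {r}))).to_subtype
  have hFfin : Finite F := LinearIndependent.finite hF
  have hE : E(Γ.restrict (Subtype.val '' F)) = Subtype.val '' F :=
    Set.inter_eq_right.2 (Subtype.coe_image_subset _ _)
  rw [isMultigraphTree_iff_connected_and_ncard (by exact hV) (by rw [hE]; exact F.toFinite.image _)]
  refine ⟨simpleGraph_connected_of_forall_eq_zero K ⟨r, hr⟩ fun f hfr hf => ?_, ?_⟩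
  · let g : ↥(V(Γ) \ {r}) → K := fun w => f ⟨w, w.2.1⟩
    have hg {v : β} (hv : v ∈ V(Γ)) : Function.extend Subtype.val g 0 v = f ⟨v, hv⟩ := by
      by_cases hvr : v = r
      · subst hvr
        rw [hfr]
        exact Function.extend_apply' _ _ _ fun ⟨w, hw⟩ => w.2.2 hw
      · exact Subtype.val_injective.extend_apply g 0 ⟨v, hv, hvr⟩
    have hfinrank := finrank_fun_sdiff_singleton_add_one (K := K) hV hr
    have hg_zero : g = 0 := by
      refine (linearIndependent_dual_iff ?_).1 hF g fun e => ?_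
      · rw [Nat.card_coe_set_eq]
        omega
      · have he := hst e
        rw [potentialDiff_apply, hg he.left_mem, hg he.right_mem, sub_eq_zero]
        by_cases hne : s e = t e
        · simp only [hne]
        · exact hf _ _ ⟨fun h => hne (congrArg Subtype.val h), _, ⟨e, e.2, rfl⟩, he⟩
    intro v
    rw [← hg v.2, hg_zero, Function.extend_zero, Pi.zero_apply]
  · rw [hE, Set.ncard_image_of_injective _ Subtype.val_injective]
    exact hcard

theorem isUnionOfTwoSpanningTrees_of_linearIndepOn (hV : V(Γ).Finite) (hr : r ∈ V(Γ))
    {s t : E(Γ) → β} (hst : ∀ e : E(Γ), Γ.IsLink e (s e) (t e))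
    (hcard : E(Γ).ncard + 2 = 2 * V(Γ).ncard) {F : Set E(Γ)}
    (hF : LinearIndepOn K (fun e => potentialDiff K (V(Γ) \ {r}) (s e) (t e)) F)
    (hFc : LinearIndepOn K (fun e => potentialDiff K (V(Γ) \ {r}) (s e) (t e)) Fᶜ) :
    Γ.IsUnionOfTwoSpanningTrees := by
  have := (hV.subset (Set.sdiff_subset (t := {r}))).to_subtype
  have : Finite F := LinearIndependent.finite hF
  have : Finite ↑Fᶜ := LinearIndependent.finite hFc
  have hfinrank := finrank_fun_sdiff_singleton_add_one (K := K) hV hr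
  have hle {S : Set E(Γ)}
      (hS : LinearIndepOn K (fun e => potentialDiff K (V(Γ) \ {r}) (s e) (t e)) S) :
      S.ncard + 1 ≤ V(Γ).ncard := by
    have : Fintype S := @Fintype.ofFinite _ (LinearIndependent.finite hS)
    have hS_card := LinearIndependent.fintype_card_le_finrank hS
    rw [← Nat.card_eq_fintype_card, Nat.card_coe_set_eq,
      Subspace.dual_finrank_eq] at hS_card
    omega
  have hsum : F.ncard + Fᶜ.ncard = E(Γ).ncard := by
    rw [← Set.ncard_union_eq disjoint_compl_right F.toFinite Fᶜ.toFinite, Set.union_compl_self,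
      Set.ncard_univ, Nat.card_coe_set_eq]
  have hF_le := hle hF
  have hFc_le := hle hFc
  refine ⟨_, _, ⟨Graph.restrict_le, rfl⟩, ⟨Graph.restrict_le, rfl⟩,
    isMultigraphTree_restrict_of_linearIndepOn hV hr hst hF (by omega),
    isMultigraphTree_restrict_of_linearIndepOn hV hr hst hFc (by omega), ?_, ?_⟩ <;>
    simp only [Graph.edgeSet_restrict, Set.inter_eq_right.2 (Subtype.coe_image_subset _ _)]
  · exact (Set.disjoint_image_iff Subtype.val_injective).2 disjoint_compl_right
  · rw [← Set.image_union, Set.union_compl_self, Subtype.coe_image_univ]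

theorem isUnionOfTwoSpanningTrees_of_forall_eq_zero (hV : V(Γ).Finite) (hE : E(Γ).Finite)
    (hr : r ∈ V(Γ)) (hcard : E(Γ).ncard + 2 = 2 * V(Γ).ncard) {s t : ε → β}
    (hst : ∀ e ∈ E(Γ), Γ.IsLink e (s e) (t e)) (a b : ε → K)
    (h : ∀ f g : β → K, f r = 0 → g r = 0 →
      (∀ e ∈ E(Γ), a e * (f (s e) - f (t e)) = b e * (g (s e) - g (t e))) →
      ∀ x ∈ V(Γ), f x = 0 ∧ g x = 0) :
    Γ.IsUnionOfTwoSpanningTrees := by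
  have := (hV.subset (Set.sdiff_subset (t := {r}))).to_subtype
  have hfinrank := finrank_fun_sdiff_singleton_add_one (K := K) hV hr
  have := hE.to_subtype
  have hext_root (u : ↥(V(Γ) \ {r}) → K) : Function.extend Subtype.val u 0 r = 0 :=
    Function.extend_apply' _ _ _ fun ⟨w, hw⟩ => w.2.2 hw
  obtain ⟨F, hF, hFc⟩ := exists_linearIndepOn_compl_of_forall_eq_zero
    (φ := fun e : E(Γ) => potentialDiff K (V(Γ) \ {r}) (s e) (t e)) (fun e => a e) (fun e => b e)
    (by rw [Nat.card_coe_set_eq]; omega) (fun u v huv => by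
      have hzero := h _ _ (hext_root u) (hext_root v) fun e he => huv ⟨e, he⟩
      have hext {u : ↥(V(Γ) \ {r}) → K} (w : ↥(V(Γ) \ {r})) :
          Function.extend Subtype.val u 0 (w : β) = u w :=
        Subtype.val_injective.extend_apply u 0 w
      exact ⟨funext fun w => (hext w).symm.trans (hzero w w.2.1).1,
        funext fun w => (hext w).symm.trans (hzero w w.2.1).2⟩)
  exact isUnionOfTwoSpanningTrees_of_linearIndepOn hV hr (fun e => hst e e.2) hcard hF hFc

end Graph

namespace MixedGraph

open Filter Topology

variable {α : Type*}

section Rigidity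

variable {G : MixedGraph α} {p d : α → Plane}

theorem exists_eq_smul_of_mul_eq_mul {x y : Plane} (hx : x ≠ 0) (hxy : x 0 * y 1 = x 1 * y 0) :
    ∃ c : ℝ, y = c • x := by
  have hinner (z : Plane) : inner ℝ x z = x 0 * z 0 + x 1 * z 1 := by
    simp [PiLp.inner_apply, Fin.sum_univ_two, mul_comm]
  refine ⟨inner ℝ x y / inner ℝ x x, ?_⟩
  rw [div_eq_inv_mul, mul_smul, eq_inv_smul_iff₀ (inner_self_ne_zero.2 hx), hinner, hinner]
  refine PiLp.ext (Fin.forall_fin_two.2 ⟨?_, ?_⟩) <;> simp only [PiLp.smul_apply, smul_eq_mul]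
  · linear_combination -x 1 * hxy
  · linear_combination x 0 * hxy

/-- The displacement `d` of the framework `(G, p)` preserves the direction of every direction edge
to first order and moves both ends of every length edge by the same vector. All constraints are
linear in `d` and hold along the whole line `p + t d`, so that `d` is an infinitesimal motion of
`(G, p)` which extends to a motion. -/
structure IsLinearMotion (G : MixedGraph α) (p d : α → Plane) : Prop where
  cross_eq : ∀ u v, s(u, v) ∈ G.D →
    (p u - p v) 1 * (d u - d v) 0 = (p u - p v) 0 * (d u - d v) 1
  eq_of_mem_len : ∀ u v, s(u, v) ∈ G.L → d u = d v

theorem IsLinearMotion.equivalent_add_smul (hd : G.IsLinearMotion p d) (t : ℝ) :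
    G.Equivalent p (fun v => p v + t • d v) := by
  refine ⟨fun u v huv hne => exists_eq_smul_of_mul_eq_mul (sub_ne_zero.2 hne) ?_, fun u v huv => ?_⟩
  · have hcross := hd.cross_eq u v huv
    simp only [PiLp.sub_apply, PiLp.add_apply, PiLp.smul_apply, smul_eq_mul] at hcross ⊢
    linear_combination t * hcross
  · simp only [hd.eq_of_mem_len u v huv, add_sub_add_right_eq_sub]

theorem IsRigidFramework.eventually_congruent (hp : G.IsRigidFramework p)
    (hd : G.IsLinearMotion p d) :
    ∀ᶠ t : ℝ in 𝓝 0, G.Congruent p (fun v => p v + t • d v) := by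
  obtain ⟨ε, hε, hcongr⟩ := hp
  have hsmall : ∀ᶠ t : ℝ in 𝓝 0, ∀ v ∈ G.V, ‖p v - (p v + t • d v)‖ < ε := by
    refine (eventually_all_finset G.V).2 fun v _ => ?_
    have hcont : Continuous fun t : ℝ => ‖p v - (p v + t • d v)‖ := by fun_prop
    exact hcont.tendsto 0 |>.eventually_lt_const (by simpa using hε)
  exact hsmall.mono fun t ht => hcongr _ (hd.equivalent_add_smul t) ht

theorem Congruent.smul_sub_eq {t : ℝ} (h : G.Congruent p (fun v => p v + t • d v)) {u v : α}
    (hu : u ∈ G.V) (hv : v ∈ G.V) :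
    t • (d u - d v) = 0 ∨ t • (d u - d v) = (-2 : ℝ) • (p u - p v) := by
  refine h.imp (fun h => ?_) fun h => ?_
  · linear_combination (norm := module) -h u hu v hv
  · linear_combination (norm := module) h u hu v hv

theorem IsRigidFramework.eq_of_isLinearMotion (hp : G.IsRigidFramework p)
    (hd : G.IsLinearMotion p d) {u v : α} (hu : u ∈ G.V) (hv : v ∈ G.V) :
    d u = d v := by
  have hcongr := hp.eventually_congruent hd
  -- If `p` were congruent to both `p + t d` and `p - t d` by a half-turn, then the edge vectors
  -- `t (d u - d v)` and `-t (d u - d v)` would coincide.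
  have hcongr_neg : ∀ᶠ t : ℝ in 𝓝 0, G.Congruent p (fun v => p v + (-t) • d v) :=
    (continuous_neg.tendsto' (0 : ℝ) 0 neg_zero).eventually hcongr
  obtain ⟨t, ⟨ht, ht_neg⟩, htpos⟩ := ((hcongr.and hcongr_neg).filter_mono
    nhdsWithin_le_nhds |>.and (self_mem_nhdsWithin (s := Set.Ioi (0 : ℝ)))).exists
  have hzero : t • (d u - d v) = 0 := by
    rcases ht.smul_sub_eq hu hv with h | h
    · exact h
    rcases ht_neg.smul_sub_eq hu hv with h' | h'
    · rwa [neg_smul, neg_eq_zero] at h'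
    · have htwo : (2 : ℝ) • t • (d u - d v) = 0 := by
        linear_combination (norm := module) h - h'
      exact (smul_eq_zero.1 htwo).resolve_left two_ne_zero
  exact sub_eq_zero.1 ((smul_eq_zero.1 hzero).resolve_left (ne_of_gt htpos))

end Rigidity

section Contraction

variable [DecidableEq α] {G H : MixedGraph α}

theorem contract_isLink {e : Edge α} {x y : Option α} :
    (G.contract H).IsLink e x y ↔ ∃ u v, (e ∈ G.edges ∧ e.ends = s(u, v)) ∧ e ∉ H.edges ∧
      H.contractMap u = x ∧ H.contractMap v = y := by
  simp only [contract, Graph.map_isLink, Relation.Map, Graph.deleteEdges_isLink, toGraph,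
    Finset.mem_coe, and_assoc]

theorem contract_edgeSet (G H : MixedGraph α) :
    (G.contract H).edgeSet = ↑G.edges \ ↑H.edges := by
  simp only [contract, toGraph, Graph.edgeSet_map, Graph.edgeSet_deleteEdges]

theorem finite_contract_edgeSet (G H : MixedGraph α) : (G.contract H).edgeSet.Finite := by
  rw [contract_edgeSet]
  exact G.edges.finite_toSet.sdiff

theorem ncard_contract_edgeSet_of_len_eq (hL : H.L = G.L) :
    (G.contract H).edgeSet.ncard = (G.D \ H.D).card := by
  have hE : (G.contract H).edgeSet = Sum.inl '' ((G.D \ H.D : Finset (Sym2 α)) : Set (Sym2 α)) := by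
    rw [contract_edgeSet]
    ext (e | e) <;> simp [edges, hL]
  rw [hE, Set.ncard_image_of_injective _ Sum.inl_injective, Set.ncard_coe_finset]

theorem contract_vertexSet (hV : H.V ⊆ G.V) :
    (G.contract H).vertexSet = ↑(insert none ((G.V \ H.V).map Function.Embedding.some)) := by
  ext x
  simp only [contract, Graph.vertexSet_map, Graph.vertexSet_deleteEdges, toGraph, contractMap,
    Set.mem_image, Finset.coe_insert, Finset.coe_map, Finset.mem_coe, Set.mem_insert_iff,
    Finset.mem_sdiff, Function.Embedding.some_apply]
  constructor
  · rintro ⟨v, hv, rfl⟩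
    by_cases hvH : v ∈ H.V <;> simp [hv, hvH]
  · rintro (rfl | ⟨v, ⟨hv, hvH⟩, rfl⟩)
    · obtain ⟨v, hv⟩ := H.nonempty
      exact ⟨v, hV hv, if_pos hv⟩
    · exact ⟨v, hv, if_neg hvH⟩

theorem finite_contract_vertexSet (hV : H.V ⊆ G.V) : (G.contract H).vertexSet.Finite := by
  rw [contract_vertexSet hV]
  exact Finset.finite_toSet _

theorem ncard_contract_vertexSet (hV : H.V ⊆ G.V) :
    (G.contract H).vertexSet.ncard = (G.V \ H.V).card + 1 := by
  rw [contract_vertexSet hV, Set.ncard_coe_finset, Finset.card_insert_of_notMem (by simp),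
    Finset.card_map]

theorem none_mem_contract_vertexSet (hV : H.V ⊆ G.V) : none ∈ (G.contract H).vertexSet := by
  rw [contract_vertexSet hV]
  exact Finset.mem_insert_self _ _

theorem IsRigidFramework.eq_zero_of_contractMap {p : α → Plane} (hp : G.IsRigidFramework p)
    (hV : H.V ⊆ G.V) (hL : G.L ⊆ H.L) {f g : Option α → ℝ} (hf : f none = 0) (hg : g none = 0)
    (hfg : ∀ u v, s(u, v) ∈ G.D \ H.D →
      (p u - p v) 1 * (f (H.contractMap u) - f (H.contractMap v)) =
        (p u - p v) 0 * (g (H.contractMap u) - g (H.contractMap v))) :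
    ∀ x ∈ (G.contract H).vertexSet, f x = 0 ∧ g x = 0 := by
  let d : α → Plane := fun v => !₂[f (H.contractMap v), g (H.contractMap v)]
  have hd_zero {v} (hv : v ∈ H.V) : d v = 0 := by
    simp only [d, contractMap, if_pos hv, hf, hg]
    exact PiLp.ext (Fin.forall_fin_two.2 ⟨rfl, rfl⟩)
  have hd_const {u v} (hu : u ∈ G.V) (hv : v ∈ G.V) : d u = d v := by
    refine hp.eq_of_isLinearMotion ⟨fun u v huv => ?_, fun u v huv => ?_⟩ hu hv
    · by_cases huvH : s(u, v) ∈ H.D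
      · rw [hd_zero (H.dir_ends _ huvH u (Sym2.mem_mk_left u v)),
          hd_zero (H.dir_ends _ huvH v (Sym2.mem_mk_right u v))]
        simp
      · exact hfg u v (Finset.mem_sdiff.2 ⟨huv, huvH⟩)
    · rw [hd_zero (H.len_ends _ (hL huv) u (Sym2.mem_mk_left u v)),
        hd_zero (H.len_ends _ (hL huv) v (Sym2.mem_mk_right u v))]
  rintro _ ⟨v, hv, rfl⟩
  obtain ⟨w, hw⟩ := H.nonempty
  have hdv : d v = 0 := (hd_const hv (hV hw)).trans (hd_zero hw)
  exact ⟨congrArg (fun z : Plane => z 0) hdv, congrArg (fun z : Plane => z 1) hdv⟩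

theorem IsRigidFramework.isUnionOfTwoSpanningTrees_contract {p : α → Plane}
    (hp : G.IsRigidFramework p) (hV : H.V ⊆ G.V) (hL : H.L = G.L)
    (hcard : (G.D \ H.D).card = 2 * (G.V \ H.V).card) :
    (G.contract H).IsUnionOfTwoSpanningTrees := by
  let out (e : Edge α) : α × α := Quot.out e.ends
  have hout (e : Edge α) : s((out e).1, (out e).2) = e.ends := Quot.out_eq e.ends
  have hlink (e) (he : e ∈ (G.contract H).edgeSet) :
      (G.contract H).IsLink e (H.contractMap (out e).1) (H.contractMap (out e).2) := by
    rw [contract_edgeSet] at he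
    exact contract_isLink.2 ⟨_, _, ⟨he.1, (hout e).symm⟩, he.2, rfl, rfl⟩
  refine isUnionOfTwoSpanningTrees_of_forall_eq_zero (finite_contract_vertexSet hV)
    (finite_contract_edgeSet G H) (none_mem_contract_vertexSet hV)
    (by rw [ncard_contract_edgeSet_of_len_eq hL, ncard_contract_vertexSet hV]; omega) hlink
    (fun e => (p (out e).1 - p (out e).2) 1) (fun e => (p (out e).1 - p (out e).2) 0)
    fun f g hf hg hfg => hp.eq_zero_of_contractMap hV hL.ge hf hg fun u v huv => ?_
  have huv_mem : Sum.inl s(u, v) ∈ (G.contract H).edgeSet := by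
    rw [contract_edgeSet]
    simpa [edges] using huv
  have huv_eq := hfg _ huv_mem
  rcases Sym2.eq_iff.1 (hout (Sum.inl s(u, v))) with ⟨hu, hv⟩ | ⟨hu, hv⟩
  · rwa [hu, hv] at huv_eq
  · rw [hu, hv] at huv_eq
    simp only [PiLp.sub_apply] at huv_eq ⊢
    linear_combination huv_eq

theorem directionPure_contract_edgeSet_iff :
    DirectionPure (G.contract H).edgeSet ↔ G.L ⊆ H.L := by
  rw [contract_edgeSet]
  simp [DirectionPure, edges, Finset.subset_iff]

end Contraction

theorem IsInducedSubgraph.not_directionReductionDelete [DecidableEq α] {G H : MixedGraph α}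
    (hH : H.IsInducedSubgraph G) : ¬ G.DirectionReductionDelete H := by
  rintro ⟨e, he, -, rfl⟩
  exact Finset.ne_of_mem_erase ((hH.mem_dir_iff e).2 ⟨he, G.dir_ends e he⟩) rfl

theorem IsInducedSubgraph.len_eq_iff_subset {G H : MixedGraph α} (hH : H.IsInducedSubgraph G) :
    H.L = G.L ↔ G.L ⊆ H.L :=
  ⟨Eq.ge, Finset.Subset.antisymm fun e he => ((hH.mem_len_iff e).1 he).1⟩

end MixedGraph

theorem mainTheorem11_general {α : Type*} [DecidableEq α] {G H : MixedGraph α} {p : α → Plane}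
    (hp : G.IsRigidFramework p) (hH : H.IsProperInducedSubgraph G) :
    G.DirectionReducibleTo H ↔
      H.L = G.L ∧ (G.D \ H.D).card = 2 * (G.V \ H.V).card := by
  rw [MixedGraph.DirectionReducibleTo, or_iff_right hH.1.not_directionReductionDelete,
    MixedGraph.DirectionReductionContract, and_iff_right hH,
    MixedGraph.directionPure_contract_edgeSet_iff, ← hH.1.len_eq_iff_subset]
  refine and_congr_right fun hL =>
    ⟨fun htrees => ?_, hp.isUnionOfTwoSpanningTrees_contract hH.1.verts_subset hL⟩
  have hcount := ncard_edgeSet_add_two_of_isUnionOfTwoSpanningTrees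
    (MixedGraph.finite_contract_vertexSet hH.1.verts_subset)
    (MixedGraph.finite_contract_edgeSet G H) htrees
  rw [MixedGraph.ncard_contract_edgeSet_of_len_eq hL,
    MixedGraph.ncard_contract_vertexSet hH.1.verts_subset] at hcount
  omega

theorem mainTheorem11 {α : Type*} [DecidableEq α] (G H : MixedGraph α)
    (hrigid : G.IsRigid) (hindep : G.IsDirectionIndependent)
    (hH : H.IsProperInducedSubgraph G) :
    G.DirectionReducibleTo H ↔
      H.L = G.L ∧ (G.D \ H.D).card = 2 * (G.V \ H.V).card := by
  obtain ⟨p, -, hp⟩ := hrigid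
  exact mainTheorem11_general hp hH
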